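/- Let $\mathfrak g$ be a compact simple Lie algebra (a finite-dimensional simple real Lie algebra with negative definite Killing form), let $\mathfrak t$ be a maximal abelian subalgebra of $\mathfrak g$, and let $\mathfrak g_{\mathbb C}$, $\mathfrak t_{\mathbb C}$ be their complexifications. Let $\Delta(\mathfrak g_{\mathbb C},\mathfrak t_{\mathbb C})$ be the root system of $\mathfrak g_{\mathbb C}$ with respect to $\mathfrak t_{\mathbb C}$, let $\{\alpha_1,\dots,\alpha_n\}$ be a system of simple roots, and let $\delta=\sum_{j=1}^n m_j\alpha_j$ be the corresponding highest root. Define $K_1,\dots,K_n\in\mathfrak t_{\mathbb C}$ by $\alpha_j(K_k)=\delta_{jk}$ (Kronecker delta). Let $i$ be an index with $m_i=3$ or $m_i=4$, let $\sigma$ be the automorphism $$\sigma=\mathrm{Ad}\Bigl(\exp\tfrac{\pi}{2}\sqrt{-1}\,K_i\Bigr)=e^{\mathrm{ad}\left(\frac{\pi}{2}\sqrt{-1}K_i\right)}$$ of $\mathfrak g$, and let $\mathfrak h=\mathfrak g^{\sigma}=\{X\in\mathfrak g:\sigma(X)=X\}$. Then for every automorphism $\mu$ of $\mathfrak g$ with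 $\mu(\mathfrak h)=\mathfrak h$ we have $$\mu\circ\sigma\circ\mu^{-1}=\sigma\quad\text{or}\quad\mu\circ\sigma\circ\mu^{-1}=\sigma^{-1}.$$ -/

import Mathlib

open scoped TensorProduct

/-- A finite-dimensional real Lie algebra is compact semisimple when its Killing form is
negative definite. -/
class IsCompactSemisimple (g : Type*) [LieRing g] [LieAlgebra ℝ g] : Prop where
  killingForm_neg : ∀ x : g, x ≠ 0 → killingForm ℝ g x x < 0

/-- `t` is a maximal abelian subalgebra of `g`: it is abelian, and it is not properly contained
in another abelian subalgebra. -/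
class IsMaximalAbelian {g : Type*} [LieRing g] [LieAlgebra ℝ g] (t : LieSubalgebra ℝ g) :
    Prop where
  lie_eq_zero : ∀ x ∈ t, ∀ y ∈ t, ⁅x, y⁆ = 0
  maximal : ∀ s : LieSubalgebra ℝ g, (∀ x ∈ s, ∀ y ∈ s, ⁅x, y⁆ = 0) → t ≤ s → s = t

noncomputable section

namespace FourSymm

section Complexification

variable {g : Type*} [LieRing g] [LieAlgebra ℝ g]

/-- The complexification `ℂ ⊗ t` of a Lie subalgebra `t` of `g`, as a complex Lie subalgebra of
the complexification `ℂ ⊗ g`. -/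
def complexify (t : LieSubalgebra ℝ g) : LieSubalgebra ℂ (ℂ ⊗[ℝ] g) where
  __ := t.toSubmodule.baseChange ℂ
  lie_mem' := by
    intro x y hx hy
    change x ∈ t.toSubmodule.baseChange ℂ at hx
    change y ∈ t.toSubmodule.baseChange ℂ at hy
    change ⁅x, y⁆ ∈ t.toSubmodule.baseChange ℂ
    rw [Submodule.baseChange_eq_span] at hx hy ⊢
    refine Submodule.span_induction₂
      (p := fun x y _ _ => ⁅x, y⁆ ∈ Submodule.span ℂ
        ((t.toSubmodule.map (TensorProduct.mk ℝ ℂ g 1) : Submodule ℝ (ℂ ⊗[ℝ] g)) : Set (ℂ ⊗[ℝ] g)))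
      ?_ (fun y _ => ?_) (fun x _ => ?_) ?_ ?_ ?_ ?_ hx hy
    · rintro - - ⟨a, ha, rfl⟩ ⟨b, hb, rfl⟩
      exact Submodule.subset_span ⟨⁅a, b⁆, t.lie_mem ha hb, by simp⟩
    · rw [zero_lie y]; exact Submodule.zero_mem _
    · rw [lie_zero x]; exact Submodule.zero_mem _
    · intro x y z _ _ _ h1 h2
      rw [add_lie x y z]; exact Submodule.add_mem _ h1 h2
    · intro x y z _ _ _ h1 h2
      rw [lie_add x y z]; exact Submodule.add_mem _ h1 h2
    · intro r x y _ _ h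
      rw [smul_lie r x y]; exact Submodule.smul_mem _ _ h
    · intro r x y _ _ h
      rw [lie_smul r x y]; exact Submodule.smul_mem _ _ h

lemma mem_complexify {t : LieSubalgebra ℝ g} {x : ℂ ⊗[ℝ] g} :
    x ∈ complexify t ↔ x ∈ t.toSubmodule.baseChange ℂ := Iff.rfl

/-- The `ℝ`-linear map `ℂ ⊗ g → g` induced by an `ℝ`-linear functional on `ℂ`. -/
def part (f : ℂ →ₗ[ℝ] ℝ) : ℂ ⊗[ℝ] g →ₗ[ℝ] g :=
  (TensorProduct.lid ℝ g).toLinearMap ∘ₗ f.rTensor g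

lemma part_tmul (f : ℂ →ₗ[ℝ] ℝ) (c : ℂ) (x : g) : part f (c ⊗ₜ[ℝ] x) = f c • x := by
  simp [part]

lemma part_lie (f : ℂ →ₗ[ℝ] ℝ) (h : g) (x : ℂ ⊗[ℝ] g) :
    part f ⁅(1 : ℂ) ⊗ₜ[ℝ] h, x⁆ = ⁅h, part f x⁆ := by
  induction x using TensorProduct.induction_on with
  | zero => rw [lie_zero ((1 : ℂ) ⊗ₜ[ℝ] h), map_zero, lie_zero]
  | tmul c y => simp [part_tmul]
  | add x y hx hy => rw [lie_add ((1 : ℂ) ⊗ₜ[ℝ] h) x y, map_add, map_add, lie_add, hx, hy]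

lemma eq_add_parts (x : ℂ ⊗[ℝ] g) :
    x = (1 : ℂ) ⊗ₜ[ℝ] part Complex.reLm x + Complex.I ⊗ₜ[ℝ] part Complex.imLm x := by
  induction x using TensorProduct.induction_on with
  | zero => simp
  | tmul c y =>
    simp only [part_tmul, ← TensorProduct.smul_tmul, ← TensorProduct.add_tmul]
    congr 1
    apply Complex.ext <;> simp
  | add x y hx hy =>
    nth_rewrite 1 [hx, hy]
    simp only [map_add, TensorProduct.tmul_add]
    abel

lemma part_mem {t : LieSubalgebra ℝ g} (f : ℂ →ₗ[ℝ] ℝ) {x : ℂ ⊗[ℝ] g}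
    (hx : x ∈ complexify t) : part f x ∈ t := by
  rw [mem_complexify, Submodule.baseChange] at hx
  obtain ⟨y, rfl⟩ := hx
  induction y using TensorProduct.induction_on with
  | zero => simp
  | tmul c y => simpa [part_tmul] using t.smul_mem _ y.2
  | add x y hx hy => simpa using t.add_mem hx hy

lemma tmul_mem {t : LieSubalgebra ℝ g} (c : ℂ) {x : g} (hx : x ∈ t) :
    c ⊗ₜ[ℝ] x ∈ complexify t :=
  Submodule.tmul_mem_baseChange_of_mem c hx

lemma mem_of_centralizes (t : LieSubalgebra ℝ g) [IsMaximalAbelian t] {a : g}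
    (ha : ∀ h ∈ t, ⁅h, a⁆ = 0) : a ∈ t := by
  have hab := IsMaximalAbelian.lie_eq_zero (t := t)
  have ha' : ∀ h ∈ t, ⁅a, h⁆ = 0 := fun h hh => by rw [← lie_skew, ha h hh, neg_zero]
  have hcomm : ∀ x ∈ t.toSubmodule ⊔ Submodule.span ℝ {a},
      ∀ y ∈ t.toSubmodule ⊔ Submodule.span ℝ {a}, ⁅x, y⁆ = 0 := by
    intro x hx y hy
    obtain ⟨u, hu, v, hv, rfl⟩ := Submodule.mem_sup.mp hx
    obtain ⟨u', hu', v', hv', rfl⟩ := Submodule.mem_sup.mp hy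
    obtain ⟨c, rfl⟩ := Submodule.mem_span_singleton.mp hv
    obtain ⟨c', rfl⟩ := Submodule.mem_span_singleton.mp hv'
    simp [hab u hu u' hu', ha u hu, ha' u' hu']
  let s : LieSubalgebra ℝ g :=
    { toSubmodule := t.toSubmodule ⊔ Submodule.span ℝ {a}
      lie_mem' := fun {x y} hx hy => by
        rw [hcomm x hx y hy]
        exact Submodule.zero_mem _ }
  have hs : s = t := IsMaximalAbelian.maximal s hcomm
    (fun x hx => (Submodule.mem_sup_left hx : x ∈ t.toSubmodule ⊔ Submodule.span ℝ {a}))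
  rw [← hs]
  exact (Submodule.mem_sup_right (Submodule.mem_span_singleton_self a) :
    a ∈ t.toSubmodule ⊔ Submodule.span ℝ {a})

instance (t : LieSubalgebra ℝ g) [IsMaximalAbelian t] : IsLieAbelian (complexify t) where
  trivial := by
    rintro ⟨x, hx⟩ ⟨y, hy⟩
    apply Subtype.ext
    change ⁅x, y⁆ = 0
    have hab := IsMaximalAbelian.lie_eq_zero (t := t)
    rw [eq_add_parts x, eq_add_parts y]
    simp [hab _ (part_mem _ hx) _ (part_mem _ hy)]

variable [Module.Finite ℝ g] [IsCompactSemisimple g]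

/-- The complexification of a compact semisimple Lie algebra has a nondegenerate Killing form. -/
instance : LieAlgebra.IsKilling ℂ (ℂ ⊗[ℝ] g) where
  killingCompl_top_eq_bot := by
    rw [eq_bot_iff]
    intro x hx
    have key : ∀ f : ℂ →ₗ[ℝ] ℝ, ∀ y : g, ∀ x : ℂ ⊗[ℝ] g,
        f (killingForm ℂ (ℂ ⊗[ℝ] g) x ((1 : ℂ) ⊗ₜ[ℝ] y)) = killingForm ℝ g (part f x) y := by
      intro f y x
      rw [killingForm, LieModule.traceForm_baseChange]
      induction x using TensorProduct.induction_on with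
      | zero => simp
      | tmul c z =>
        simp only [LinearMap.BilinForm.baseChange_tmul, part_tmul, map_smul,
          LinearMap.smul_apply, smul_eq_mul, mul_one]
        exact mul_comm _ _
      | add x z hx hz => simp [hx, hz]
    have hz : ∀ f : ℂ →ₗ[ℝ] ℝ, part f x = 0 := by
      intro f
      by_contra hne
      have := IsCompactSemisimple.killingForm_neg _ hne
      rw [← key, LieModule.traceForm_comm] at this
      rw [LieIdeal.mem_killingCompl] at hx
      rw [hx _ (by simp)] at this
      simp at this
    rw [eq_add_parts x, hz, hz]
    simp

/-- The complexification of a maximal abelian subalgebra of a compact semisimple Lie algebra is a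
Cartan subalgebra of the complexification. -/
instance (t : LieSubalgebra ℝ g) [IsMaximalAbelian t] : (complexify t).IsCartanSubalgebra where
  nilpotent := inferInstance
  self_normalizing := by
    refine le_antisymm (fun x hx => ?_) (complexify t).le_normalizer
    rw [LieSubalgebra.mem_normalizer_iff'] at hx
    have hp : ∀ f : ℂ →ₗ[ℝ] ℝ, part f x ∈ t := by
      intro f
      refine mem_of_centralizes t fun h hh => ?_
      have h1 : ⁅h, part f x⁆ ∈ t := by
        rw [← part_lie]
        exact part_mem f (hx _ (tmul_mem 1 hh))
      have h2 : ⁅h, ⁅h, part f x⁆⁆ = 0 := IsMaximalAbelian.lie_eq_zero h hh _ h1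
      by_contra hne
      have h3 := IsCompactSemisimple.killingForm_neg _ hne
      rw [LieModule.traceForm_apply_lie_apply', h2] at h3
      simp at h3
    rw [eq_add_parts x]
    exact add_mem (tmul_mem _ (hp _)) (tmul_mem _ (hp _))

end Complexification

section RootData

variable {g : Type*} [LieRing g] [LieAlgebra ℝ g] [Module.Finite ℝ g] [IsCompactSemisimple g]
  (t : LieSubalgebra ℝ g) [IsMaximalAbelian t]

/-- The root system of `ℂ ⊗ g` with respect to the Cartan subalgebra `ℂ ⊗ t`. -/
abbrev roots : RootPairing (complexify t).root ℂ (Module.Dual ℂ (complexify t)) (complexify t) :=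
  LieAlgebra.IsKilling.rootSystem (complexify t)

variable {t}

/-- `δ` is the highest root with respect to the base `b`: for every root `β`, the difference
`δ - β` is a sum of simple roots. -/
def IsHighestRoot (b : (roots t).Base) (δ : (complexify t).root) : Prop :=
  ∀ β : (complexify t).root,
    (roots t).root δ - (roots t).root β ∈ AddSubmonoid.closure ((roots t).root '' b.support)

/-- The element `K_i` of the basis of `ℂ ⊗ t` dual to the basis of simple roots. -/
def fundCoweight (b : (roots t).Base) (i : b.support) : complexify t :=
  (Module.evalEquiv ℂ (complexify t)).symm (b.toWeightBasis.coord i)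

/-- The defining property of `K`: `α_j (K_i)` is `1` if `j = i`, and `0` otherwise. -/
lemma root_fundCoweight [DecidableEq (complexify t).root] (b : (roots t).Base)
    (i j : b.support) :
    (roots t).root j (fundCoweight b i) = if j = i then 1 else 0 := by
  rw [fundCoweight, Module.apply_evalEquiv_symm_apply, Module.Basis.coord_apply,
    RootPairing.Base.toWeightBasis_repr_root, Finsupp.single_apply]

end RootData

/-- The exponential of an endomorphism of a finite-dimensional complex vector space, computed as
the matrix exponential in a basis (the result does not depend on the basis). -/
def expEnd {V : Type*} [AddCommGroup V] [Module ℂ V] [Module.Finite ℂ V]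
    (f : Module.End ℂ V) : Module.End ℂ V :=
  Matrix.toLin (Module.finBasis ℂ V) (Module.finBasis ℂ V)
    (NormedSpace.exp (LinearMap.toMatrix (Module.finBasis ℂ V) (Module.finBasis ℂ V) f))

/-- `Ad (exp x) = exp (ad x)`, acting on a finite-dimensional complex Lie algebra. -/
def AdExp {L : Type*} [LieRing L] [LieAlgebra ℂ L] [Module.Finite ℂ L] (x : L) :
    Module.End ℂ L :=
  expEnd (LieAlgebra.ad ℂ L x)

/-- The subalgebra of fixed points of an automorphism. -/
def fixedPoints {g : Type*} [LieRing g] [LieAlgebra ℝ g] (σ : g ≃ₗ⁅ℝ⁆ g) : LieSubalgebra ℝ g where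
  carrier := {x | σ x = x}
  add_mem' {x y} (hx : σ x = x) (hy : σ y = y) := show σ (x + y) = x + y by rw [map_add, hx, hy]
  zero_mem' := map_zero σ
  smul_mem' c x (hx : σ x = x) := show σ (c • x) = c • x by rw [map_smul, hx]
  lie_mem' {x y} (hx : σ x = x) (hy : σ y = y) := show σ ⁅x, y⁆ = ⁅x, y⁆ by
    rw [LieEquiv.map_lie, hx, hy]

end FourSymm

end

/-! An automorphism of `ℂ ⊗ g` fixing the Cartan subalgebra and all simple root spaces pointwise is
the identity (`apply_eq_self_of_forall_simple`), because these together with the negative simple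
root spaces generate. Put `τ = μ σ μ⁻¹`. It fixes `μ(𝔥) = 𝔥` pointwise, so after complexification it
fixes all that `σ` fixes: `complexify t` and the root spaces of `α_j`, `j ≠ i`. On the line of
`α_i`, `σ` acts by `I` and `τ` by some scalar `c`. A word in `σ` and `τ` is thus trivial once its
scalar there is `1`. From `σ⁴ = 1` follows `c⁴ = 1`; and `c² = 1` would give `τ² = 1`, hence `σ² =
1`, although `σ²` acts by `-1`. So `c = ±I`, that is, `τ = σ` or `τ = σ⁻¹`. -/

namespace LieAlgebra.IsKilling

open LieModule Module

/-! ### Generation by simple root spaces -/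

section

variable {K L : Type*} [Field K] [CharZero K] [LieRing L] [LieAlgebra K L]
  [IsKilling K L] [FiniteDimensional K L]
  {H : LieSubalgebra K L} [H.IsCartanSubalgebra] [IsTriangularizable K H L]

lemma exists_smul_eq_of_mem_rootSpace {α : Weight K H L} (hα : α.IsNonZero) {x y : L}
    (hx : x ∈ rootSpace H α) (hx₀ : x ≠ 0) (hy : y ∈ rootSpace H α) : ∃ c : K, c • x = y := by
  simpa using (finrank_eq_one_iff_of_nonzero' ⟨x, hx⟩ (by simpa using hx₀)).mp
    (finrank_rootSpace_eq_one _ hα) ⟨y, hy⟩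

/-- The bracket of nonzero root vectors whose roots add up to a root is nonzero. -/
lemma lie_ne_zero_of_rootSpace_add_ne_bot {α β : Weight K H L} (hα : α.IsNonZero)
    (hβ : β.IsNonZero) (hαβ : rootSpace H (α + β) ≠ ⊥) {x y : L}
    (hx : x ∈ rootSpace H α) (hx₀ : x ≠ 0) (hy : y ∈ rootSpace H β) (hy₀ : y ≠ 0) :
    ⁅x, y⁆ ≠ 0 := by
  obtain ⟨h, e, f, isSl2, he, hf⟩ := exists_isSl2Triple_of_weight_isNonZero hα
  obtain rfl := isSl2.h_eq_coroot hα he hf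
  -- A vector `z` at the top of the `α`-chain through `β` is primitive, and lowering it `q + 1 =
  -- chainTopCoeff α β` times lands in the root space of `β`.
  obtain ⟨z, hz, hz₀⟩ := (chainTop α β).exists_ne_zero
  have prim : isSl2.HasPrimitiveVectorWith z (chainLength α β : K) :=
    have := lie_mem_genWeightSpace_of_mem_genWeightSpace he hz
    ⟨hz₀, (chainLength_smul _ _ hz).symm, by rwa [genWeightSpace_add_chainTop _ _ hα] at this⟩
  have htop : 1 ≤ chainTopCoeff α β := by
    have := ((rootSpace_zsmul_add_ne_bot_iff α β hα 1).mp (by simpa using hαβ)).1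
    exact_mod_cast this
  obtain ⟨q, hq⟩ := Nat.exists_eq_add_of_le' htop
  have hlen : q + 1 ≤ chainLength α β := hq ▸ chainTopCoeff_le_chainLength α β
  have hw := toEnd_pow_apply_mem hf hz (q + 1)
  have hwt : (q + 1) • (-(α : H → K)) + chainTop α β = β := by
    rw [coe_chainTop', hq]
    simp
  rw [hwt] at hw
  obtain ⟨c, rfl⟩ := exists_smul_eq_of_mem_rootSpace hα hx hx₀ he
  obtain ⟨d, hd⟩ := exists_smul_eq_of_mem_rootSpace hβ hy hy₀ hw
  intro hxy
  -- With `N` the chain length, `e f^(q+1) z = (q+1)(N-q) f^q z`, which is nonzero since `q < N`.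
  have key := prim.lie_e_pow_succ_toEnd_f q
  rw [← hd, lie_smul, smul_lie, hxy, smul_zero, smul_zero, eq_comm, smul_eq_zero] at key
  have h1 : ((q : K) + 1) ≠ 0 := Nat.cast_add_one_ne_zero q
  have h2 : (chainLength α β : K) - q ≠ 0 := by
    rw [sub_ne_zero]
    exact_mod_cast (by lia : chainLength α β ≠ q)
  rcases key with key | key
  · exact (mul_ne_zero h1 h2) key
  · exact prim.pow_toEnd_f_ne_zero_of_eq_nat rfl (by lia) key

/-- A subalgebra containing two root spaces also contains the root space of the sum. -/
lemma rootSpace_add_le_of_le {S : LieSubalgebra K L} {α β γ : Weight K H L}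
    (hα : α.IsNonZero) (hβ : β.IsNonZero) (hγ : γ.IsNonZero) (hadd : (γ : H → K) = α + β)
    (hαS : (rootSpace H α).toSubmodule ≤ S.toSubmodule)
    (hβS : (rootSpace H β).toSubmodule ≤ S.toSubmodule) :
    (rootSpace H γ).toSubmodule ≤ S.toSubmodule := by
  intro z hz
  obtain ⟨x, hx, hx₀⟩ := α.exists_ne_zero
  obtain ⟨y, hy, hy₀⟩ := β.exists_ne_zero
  have hxy : ⁅x, y⁆ ∈ rootSpace H γ := by
    rw [hadd]
    exact lie_mem_genWeightSpace_of_mem_genWeightSpace hx hy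
  have h₀ : ⁅x, y⁆ ≠ 0 := lie_ne_zero_of_rootSpace_add_ne_bot hα hβ
    (hadd ▸ γ.genWeightSpace_ne_bot) hx hx₀ hy hy₀
  obtain ⟨c, rfl⟩ := exists_smul_eq_of_mem_rootSpace hγ hxy h₀ hz
  exact S.smul_mem c (S.lie_mem (hαS hx) (hβS hy))

/-- A Lie algebra with nondegenerate Killing form is generated by a Cartan subalgebra together
with the root spaces of the simple roots and their negatives. -/
lemma eq_top_of_forall_simple_rootSpace_le (b : (rootSystem H).Base) {S : LieSubalgebra K L}
    (hH : H ≤ S)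
    (hpos : ∀ j ∈ b.support, (rootSpace H j.1).toSubmodule ≤ S.toSubmodule)
    (hneg : ∀ j ∈ b.support, (rootSpace H (-j.1 : Weight K H L)).toSubmodule ≤ S.toSubmodule) :
    S = ⊤ := by
  -- Treating `k` and `-k` together makes the negation step of the induction a mere swap.
  have key : ∀ k : H.root, (rootSpace H k.1).toSubmodule ≤ S.toSubmodule ∧
      (rootSpace H (-k.1 : Weight K H L)).toSubmodule ≤ S.toSubmodule := by
    intro k
    induction k using b.induction_add with
    | h₀ k hk =>
      have : ((rootSystem H).reflectionPerm k k).1 = -k.1 := by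
        apply Weight.ext
        intro x
        have := (rootSystem H).root_reflectionPerm k k
        rw [RootPairing.reflection_apply_self] at this
        exact LinearMap.congr_fun this x
      rw [this, neg_neg]
      exact hk.symm
    | h₁ k hk => exact ⟨hpos k hk, hneg k hk⟩
    | h₂ k j l hl hk hj =>
      have hadd : (l.1 : H → K) = k.1 + j.1 := by
        ext x
        simpa using LinearMap.congr_fun hl x
      have nz := H.isNonZero_coe_root (K := K)
      refine ⟨rootSpace_add_le_of_le (nz k) (nz j) (nz l) hadd hk.1 (hpos j hj),
        rootSpace_add_le_of_le (nz k).neg (nz j).neg (nz l).neg ?_ hk.2 (hneg j hj)⟩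
      rw [Weight.coe_neg, Weight.coe_neg, Weight.coe_neg, hadd, neg_add]
  rw [← LieSubalgebra.toSubmodule_inj, LieSubalgebra.top_toSubmodule, eq_top_iff,
    ← LieSubmodule.top_toSubmodule (R := K) (L := H), ← iSup_genWeightSpace_eq_top' K H L,
    LieSubmodule.iSup_toSubmodule, iSup_le_iff]
  intro α
  by_cases hα : α.IsZero
  · have : rootSpace H (α : H → K) = H.toLieSubmodule := by
      rw [hα.eq]
      exact rootSpace_zero_eq K L H
    intro x hx
    exact hH (this ▸ hx : x ∈ H.toLieSubmodule)
  · exact (key ⟨α, by simpa using hα⟩).1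

/-- An endomorphism fixing a Cartan subalgebra pointwise preserves each root space. -/
lemma map_mem_rootSpace {θ : L →ₗ⁅K⁆ L} (hθ : ∀ h ∈ H, θ h = h) {α : H → K} {x : L}
    (hx : x ∈ rootSpace H α) : θ x ∈ rootSpace H α := by
  rw [mem_genWeightSpace]
  refine fun h ↦ ⟨1, ?_⟩
  have := congrArg θ (lie_eq_smul_of_mem_rootSpace hx h)
  rw [H.coe_bracket_of_module, LieHom.map_lie, hθ _ h.2, map_smul] at this
  simp [this]

/-- An endomorphism fixing pointwise a Cartan subalgebra and the root spaces of the simple roots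
is the identity. -/
lemma apply_eq_self_of_forall_simple (b : (rootSystem H).Base) {θ : L →ₗ⁅K⁆ L}
    (hH : ∀ h ∈ H, θ h = h) (hpos : ∀ j ∈ b.support, ∀ x ∈ rootSpace H j.1, θ x = x) (x : L) :
    θ x = x := by
  let S : LieSubalgebra K L :=
    { toSubmodule := LinearMap.eqLocus (θ : L →ₗ[K] L) LinearMap.id
      lie_mem' := fun {x y} (hx : θ x = x) (hy : θ y = y) ↦
        show θ ⁅x, y⁆ = ⁅x, y⁆ by rw [LieHom.map_lie, hx, hy] }
  suffices h : S = ⊤ by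
    have hx : x ∈ S := h ▸ LieSubalgebra.mem_top x
    exact hx
  refine eq_top_of_forall_simple_rootSpace_le b hH hpos fun j hj y hy ↦ ?_
  have hj₀ := H.isNonZero_coe_root (K := K) j
  obtain ⟨h, e, f, isSl2, he, hf⟩ := exists_isSl2Triple_of_weight_isNonZero hj₀
  rw [← Weight.coe_neg] at hf
  -- On the negative root line `θ f = c • f`. As `θ` fixes `e` and `h = ⁅e, f⁆ ≠ 0`, this forces `c
  -- = 1`.
  obtain ⟨c, hc⟩ := exists_smul_eq_of_mem_rootSpace hj₀.neg hf isSl2.f_ne_zero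
    (map_mem_rootSpace hH hf)
  have hh : θ h = h := by
    rw [isSl2.h_eq_coroot hj₀ he hf]
    exact hH _ (coroot j.1).2
  have hc₁ : c • h = (1 : K) • h := by
    rw [← isSl2.lie_e_f, ← lie_smul, hc, one_smul, isSl2.lie_e_f]
    nth_rewrite 1 [← hpos j hj e he]
    rw [← LieHom.map_lie, isSl2.lie_e_f, hh]
  have := smul_left_injective K isSl2.h_ne_zero hc₁
  subst this
  obtain ⟨d, rfl⟩ := exists_smul_eq_of_mem_rootSpace hj₀.neg hf isSl2.f_ne_zero hy
  change θ (d • f) = d • f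
  rw [map_smul, ← hc, one_smul]

end

end LieAlgebra.IsKilling

/-! ### The exponential on eigenvectors -/

namespace FourSymm

lemma expEnd_apply_of_eigen {V : Type*} [AddCommGroup V] [Module ℂ V] [Module.Finite ℂ V]
    (f : Module.End ℂ V) {c : ℂ} {v : V} (h : f v = c • v) :
    expEnd f v = Complex.exp c • v := by
  let B := Module.finBasis ℂ V
  let M := LinearMap.toMatrix B B f
  have hpow : ∀ n : ℕ, (f ^ n) v = c ^ n • v := by
    intro n
    induction n with
    | zero => simp
    | succ n ih => rw [pow_succ', Module.End.mul_apply, ih, map_smul, h, smul_smul, pow_succ]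
  let E : Matrix (Fin (Module.finrank ℂ V)) (Fin (Module.finrank ℂ V)) ℂ →ₗ[ℂ] V :=
    (LinearMap.applyₗ v) ∘ₗ (Matrix.toLin B B).toLinearMap
  have hE : ∀ n : ℕ, E (M ^ n) = c ^ n • v := fun n ↦ by
    change Matrix.toLin B B (LinearMap.toMatrix B B f ^ n) v = c ^ n • v
    rw [← hpow n, LinearMap.toMatrix_pow, Matrix.toLin_toMatrix]
  let := Matrix.linftyOpNormedRing (n := Fin (Module.finrank ℂ V)) (α := ℂ)
  let := Matrix.linftyOpNormedAlgebra (n := Fin (Module.finrank ℂ V)) (R := ℂ) (α := ℂ)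
  have hM : HasSum (fun n : ℕ => ((n.factorial : ℂ)⁻¹) • M ^ n) (NormedSpace.exp M) :=
    NormedSpace.exp_series_hasSum_exp' (𝕂 := ℂ) M
  -- `V` carries no topology, so the two series are compared in coordinates.
  let φ : V ≃ₗ[ℂ] (Fin (Module.finrank ℂ V) → ℂ) := B.equivFun
  have h1 := hM.mapL (LinearMap.toContinuousLinearMap (φ.toLinearMap ∘ₗ E))
  have h2 : HasSum (fun n : ℕ => ((n.factorial : ℂ)⁻¹) • c ^ n) (NormedSpace.exp c) :=
    NormedSpace.exp_series_hasSum_exp' (𝕂 := ℂ) c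
  have h3 := h2.smul_const (φ v)
  simp only [LinearMap.coe_toContinuousLinearMap', map_smul, LinearMap.comp_apply, hE,
    LinearEquiv.coe_coe] at h1
  simp only [smul_assoc] at h3
  have := h1.unique h3
  rw [← map_smul, φ.injective.eq_iff, ← Complex.exp_eq_exp_ℂ] at this
  exact this

end FourSymm
open LieAlgebra LieAlgebra.IsKilling LieModule

namespace FourSymm

/-! ### Complexified homomorphisms -/

section
variable {g : Type*} [LieRing g] [LieAlgebra ℝ g]

/-- The complexification of a homomorphism of real Lie algebras. -/
noncomputable def complexifyHom (φ : g →ₗ⁅ℝ⁆ g) : ℂ ⊗[ℝ] g →ₗ⁅ℂ⁆ ℂ ⊗[ℝ] g where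
  __ := (φ : g →ₗ[ℝ] g).baseChange ℂ
  map_lie' {x y} := by
    change (φ : g →ₗ[ℝ] g).baseChange ℂ ⁅x, y⁆ =
      ⁅(φ : g →ₗ[ℝ] g).baseChange ℂ x, (φ : g →ₗ[ℝ] g).baseChange ℂ y⁆
    rw [eq_add_parts x, eq_add_parts y]
    simp only [map_add, add_lie, lie_add,
      LieAlgebra.ExtendScalars.bracket_tmul, LinearMap.baseChange_tmul, LieHom.coe_toLinearMap,
      LieHom.map_lie]
    abel

lemma complexifyHom_tmul (φ : g →ₗ⁅ℝ⁆ g) (c : ℂ) (x : g) :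
    complexifyHom φ (c ⊗ₜ[ℝ] x) = c ⊗ₜ[ℝ] φ x :=
  LinearMap.baseChange_tmul ..

lemma complexifyHom_comp (φ ψ : g →ₗ⁅ℝ⁆ g) (x : ℂ ⊗[ℝ] g) :
    complexifyHom (φ.comp ψ) x = complexifyHom φ (complexifyHom ψ x) :=
  LinearMap.congr_fun (LinearMap.baseChange_comp (A := ℂ) (ψ : g →ₗ[ℝ] g) (φ : g →ₗ[ℝ] g)) x

/-- Lets a fixed vector of the complexification be split into real and imaginary parts that are
themselves fixed. -/
lemma part_complexifyHom (f : ℂ →ₗ[ℝ] ℝ) (φ : g →ₗ⁅ℝ⁆ g) (x : ℂ ⊗[ℝ] g) :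
    part f (complexifyHom φ x) = φ (part f x) := by
  induction x using TensorProduct.induction_on with
  | zero => simp
  | tmul c y => simp [part_tmul, complexifyHom_tmul]
  | add x y hx hy => simp [hx, hy]

lemma one_tmul_injective : Function.Injective fun x : g ↦ (1 : ℂ) ⊗ₜ[ℝ] x := fun x y h ↦ by
  simpa [part_tmul] using congrArg (part Complex.reLm) h

/-- If every vector fixed by `φ` is fixed by `ψ`, the same holds for the complexifications. -/
lemma complexifyHom_eq_self_of_forall {φ ψ : g →ₗ⁅ℝ⁆ g} (h : ∀ x, φ x = x → ψ x = x)
    {x : ℂ ⊗[ℝ] g} (hx : complexifyHom φ x = x) : complexifyHom ψ x = x := by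
  have hp : ∀ f : ℂ →ₗ[ℝ] ℝ, ψ (part f x) = part f x := fun f ↦
    h _ (by rw [← part_complexifyHom, hx])
  rw [eq_add_parts x, map_add, complexifyHom_tmul, complexifyHom_tmul, hp, hp]

end

section
variable {g : Type*} [LieRing g] [LieAlgebra ℝ g] [Module.Finite ℝ g] [IsCompactSemisimple g]
  {t : LieSubalgebra ℝ g} [IsMaximalAbelian t]

/-- An endomorphism is the identity as soon as its complexification fixes pointwise the Cartan
subalgebra and the simple root spaces. -/
lemma apply_eq_self_of_complexifyHom (b : (roots t).Base) {φ : g →ₗ⁅ℝ⁆ g}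
    (hH : ∀ h ∈ complexify t, complexifyHom φ h = h)
    (hpos : ∀ j ∈ b.support, ∀ x ∈ rootSpace (complexify t) j.1, complexifyHom φ x = x) (x : g) :
    φ x = x := by
  apply one_tmul_injective
  have := apply_eq_self_of_forall_simple b hH hpos ((1 : ℂ) ⊗ₜ[ℝ] x)
  rwa [complexifyHom_tmul] at this

lemma AdExp_apply_of_mem_rootSpace (c : ℂ) (k : complexify t) {α : complexify t → ℂ}
    {x : ℂ ⊗[ℝ] g} (hx : x ∈ rootSpace (complexify t) α) :
    AdExp (c • (k : ℂ ⊗[ℝ] g)) x = Complex.exp (c * α k) • x := by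
  apply expEnd_apply_of_eigen
  have := lie_eq_smul_of_mem_rootSpace hx k
  rw [LieSubalgebra.coe_bracket_of_module] at this
  rw [map_smul, LinearMap.smul_apply, LieAlgebra.ad_apply, this, smul_smul]

lemma AdExp_apply_of_mem_complexify (c : ℂ) (k : complexify t)
    {x : ℂ ⊗[ℝ] g} (hx : x ∈ complexify t) :
    AdExp (c • (k : ℂ ⊗[ℝ] g)) x = x := by
  have h0 : x ∈ rootSpace (complexify t) (0 : complexify t → ℂ) := by
    rw [rootSpace_zero_eq ℂ (ℂ ⊗[ℝ] g) (complexify t)]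
    exact hx
  simpa using AdExp_apply_of_mem_rootSpace c k h0

end

end FourSymm

/-! ### The conjugate of `σ` -/

open FourSymm in
theorem lemma3p1 {g : Type*} [LieRing g] [LieAlgebra ℝ g] [Module.Finite ℝ g]
    [LieAlgebra.IsSimple ℝ g] [IsCompactSemisimple g]
    (t : LieSubalgebra ℝ g) [IsMaximalAbelian t]
    (b : (FourSymm.roots t).Base)
    (δ : (FourSymm.complexify t).root) (hδ : FourSymm.IsHighestRoot b δ)
    (m : b.support → ℤ)
    (hm : (FourSymm.roots t).root δ = ∑ j : b.support, m j • (FourSymm.roots t).root j)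
    (i : b.support) (hi : m i = 3 ∨ m i = 4)
    (σ : g ≃ₗ⁅ℝ⁆ g)
    (hσ : (σ : g →ₗ[ℝ] g).baseChange ℂ =
      FourSymm.AdExp (((Real.pi / 2 : ℂ) * Complex.I) •
        (FourSymm.fundCoweight b i : TensorProduct ℝ ℂ g)))
    (μ : g ≃ₗ⁅ℝ⁆ g)
    (hμ : (FourSymm.fixedPoints σ).map (μ : g →ₗ⁅ℝ⁆ g) = FourSymm.fixedPoints σ) :
    (μ.symm.trans σ).trans μ = σ ∨ (μ.symm.trans σ).trans μ = σ.symm := by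
  classical
  set τ := (μ.symm.trans σ).trans μ
  have hτ_apply : ∀ x, τ x = μ (σ (μ.symm x)) := fun x ↦ rfl
  let σ₀ : g →ₗ⁅ℝ⁆ g := σ
  let τ₀ : g →ₗ⁅ℝ⁆ g := τ
  have hS : ∀ x, complexifyHom σ₀ x = _ := fun x ↦ LinearMap.congr_fun hσ x
  have hSH : ∀ x ∈ complexify t, complexifyHom σ₀ x = x := fun x hx ↦ by
    rw [hS, AdExp_apply_of_mem_complexify _ _ hx]
  have hSj : ∀ j : b.support, j ≠ i → ∀ x ∈ rootSpace (complexify t) j.1.1,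
      complexifyHom σ₀ x = x := fun j hj x hx ↦ by
    have hk := root_fundCoweight b i j
    rw [if_neg hj, rootSystem_root_apply, Weight.toLinear_apply] at hk
    rw [hS, AdExp_apply_of_mem_rootSpace _ _ hx, hk, mul_zero, Complex.exp_zero, one_smul]
  have hSi : ∀ x ∈ rootSpace (complexify t) i.1.1, complexifyHom σ₀ x = Complex.I • x :=
    fun x hx ↦ by
    have hk := root_fundCoweight b i i
    rw [if_pos rfl, rootSystem_root_apply, Weight.toLinear_apply] at hk
    rw [hS, AdExp_apply_of_mem_rootSpace _ _ hx, hk, mul_one, Complex.exp_pi_div_two_mul_I]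
  have hfix : ∀ x, σ₀ x = x → τ₀ x = x := fun x hx ↦ by
    have hx' : x ∈ fixedPoints σ := hx
    rw [← hμ] at hx'
    obtain ⟨y, hy, rfl⟩ := hx'
    change σ y = y at hy
    change μ (σ (μ.symm (μ y))) = μ y
    rw [LieEquiv.symm_apply_apply, hy]
  have hT : ∀ x, complexifyHom σ₀ x = x → complexifyHom τ₀ x = x := fun x hx ↦
    complexifyHom_eq_self_of_forall hfix hx
  have hTH : ∀ x ∈ complexify t, complexifyHom τ₀ x = x := fun x hx ↦ hT x (hSH x hx)
  have hi₀ := (complexify t).isNonZero_coe_root (K := ℂ) i.1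
  obtain ⟨e, he, he₀⟩ := i.1.1.exists_ne_zero
  obtain ⟨c, hc⟩ := exists_smul_eq_of_mem_rootSpace hi₀ he he₀ (map_mem_rootSpace hTH he)
  have hTi : ∀ x ∈ rootSpace (complexify t) i.1.1, complexifyHom τ₀ x = c • x := fun x hx ↦ by
    obtain ⟨d, rfl⟩ := exists_smul_eq_of_mem_rootSpace hi₀ he he₀ hx
    rw [map_smul, ← hc, smul_comm]
  -- words in `σ` and `τ` are trivial once they are trivial on the root space of `αᵢ`
  have triv : ∀ φ : g →ₗ⁅ℝ⁆ g, (∀ x, complexifyHom σ₀ x = x → complexifyHom φ x = x) →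
      (∀ x ∈ rootSpace (complexify t) i.1.1, complexifyHom φ x = x) → ∀ x, φ x = x :=
    fun φ h₁ h₂ ↦ apply_eq_self_of_complexifyHom b (fun x hx ↦ h₁ x (hSH x hx)) fun j hj x hx ↦ by
      by_cases hji : (⟨j, hj⟩ : b.support) = i
      · subst hji
        exact h₂ x hx
      · exact h₁ x (hSj ⟨j, hj⟩ hji x hx)
  have hσ4 : ∀ x, σ (σ (σ (σ x))) = x := by
    refine triv (σ₀.comp (σ₀.comp (σ₀.comp σ₀))) (fun x hx ↦ ?_) fun x hx ↦ ?_
    · simp only [complexifyHom_comp, hx]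
    · simp only [complexifyHom_comp, hSi x hx, map_smul, smul_smul]
      simp
  have hτ4 : ∀ x, τ (τ (τ (τ x))) = x := fun x ↦ by simp [hτ_apply, hσ4]
  have hc4 : c * (c * (c * c)) = 1 := by
    have h4 : complexifyHom (τ₀.comp (τ₀.comp (τ₀.comp τ₀))) e = e :=
      -- Comparing with the identity carries `τ⁴ = 1` from `g` to `ℂ ⊗ g`.
      complexifyHom_eq_self_of_forall (φ := LieHom.id) (fun x _ ↦ hτ4 x) (by
        rw [eq_add_parts e, map_add, complexifyHom_tmul, complexifyHom_tmul]; rfl)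
    simp only [complexifyHom_comp, hTi e he, map_smul, smul_smul] at h4
    refine smul_left_injective ℂ he₀ ?_
    simpa [mul_assoc] using h4
  have hc2 : c * c ≠ 1 := fun hcc ↦ by
    have hτ2 : ∀ x, τ (τ x) = x := by
      refine triv (τ₀.comp τ₀) (fun x hx ↦ ?_) fun x hx ↦ ?_
      · simp only [complexifyHom_comp, hT x hx]
      · simp only [complexifyHom_comp, hTi x hx, map_smul, smul_smul, hcc, one_smul]
    have hσ2 : ∀ x, σ (σ x) = x := fun x ↦ by
      have := hτ2 (μ x)
      simp only [hτ_apply, LieEquiv.symm_apply_apply] at this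
      exact μ.injective this
    have h2 : complexifyHom (σ₀.comp σ₀) e = e :=
      complexifyHom_eq_self_of_forall (φ := LieHom.id) (fun x _ ↦ hσ2 x) (by
        rw [eq_add_parts e, map_add, complexifyHom_tmul, complexifyHom_tmul]; rfl)
    simp only [complexifyHom_comp, hSi e he, map_smul, smul_smul, Complex.I_mul_I] at h2
    have : (-1 : ℂ) = 1 := smul_left_injective ℂ he₀ (by simpa using h2)
    norm_num at this
  have hcI : (c - Complex.I) * (c + Complex.I) = 0 := by
    have : (c * c - 1) * ((c - Complex.I) * (c + Complex.I)) = 0 := by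
      linear_combination hc4 - (c * c - 1) * Complex.I_mul_I
    exact (mul_eq_zero.mp this).resolve_left (sub_ne_zero.mpr hc2)
  rcases mul_eq_zero.mp hcI with h | h
  · left
    rw [sub_eq_zero] at h
    subst h
    -- Since `σ³ = σ⁻¹`, it is enough that `τσ³` has scalar `I · I³ = 1`.
    have key : ∀ x, τ (σ (σ (σ x))) = x := by
      refine triv (τ₀.comp (σ₀.comp (σ₀.comp σ₀))) (fun x hx ↦ ?_) fun x hx ↦ ?_
      · simp only [complexifyHom_comp, hx, hT x hx]
      · simp only [complexifyHom_comp, hSi x hx, hTi x hx, map_smul, smul_smul]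
        simp
    ext x
    have := key (σ x)
    rwa [hσ4] at this
  · right
    have h' : c = -Complex.I := eq_neg_of_add_eq_zero_left h
    have key : ∀ x, τ (σ x) = x := by
      refine triv (τ₀.comp σ₀) (fun x hx ↦ ?_) fun x hx ↦ ?_
      · simp only [complexifyHom_comp, hx, hT x hx]
      · simp only [complexifyHom_comp, hSi x hx, hTi x hx, map_smul, smul_smul, h']
        simp
    ext x
    have := key (σ.symm x)
    rwa [LieEquiv.apply_symm_apply] at this
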